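/- Let $d\ge 0$ be an integer and let $S=\{\mathbf v_1,\dots,\mathbf v_N\}\subset\mathbb R^d$ be a finite set of $N$ distinct points that is spanning, i.e. not contained in any affine hyperplane of $\mathbb R^d$. A $d$-simplex is the convex hull of a spanning set of $d+1$ points, and its standard measure is $\mu_\Delta=\chi_\Delta\,dx_1\cdots dx_d$. For a signed measure $\mu$ on $\mathbb R^d$ with finite moments $m_I(\mu)=\int \mathbf x^I\,d\mu(\mathbf x)$, $I=(i_1,\dots,i_d)\in\mathbb Z_{\ge 0}^d$, its Fantappiè transform (normalized moment generating function) is the power series $$F_\mu(\mathbf u)=\sum_{I\ge 0}\frac{(|I|+d)!}{i_1!\cdots i_d!}\,m_I(\mu)\,\mathbf u^I .$$ Let $\mathfrak M^\Delta(S)$ be the real linear span of the measures $\mu_\Delta$, where $\Delta$ runs over all $d$-simplices whose vertices lie in $S$, and let $\mathfrak F^\Delta(S)=\{F_\mu:\mu\in\mathfrak M^\Delta(S)\}$. Let $\mathfrak{Rat}(S)$ be the space of all rational functions $$\frac{P(\mathbf u)}{\prod_{i=1}^N(1-\langle\mathbf v_i,\mathbf u\rangle)},$$ where $P$ is any real polynomial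 in $u_1,\dots,u_d$ of degree at most $N-d-1$ (common factors are allowed), each identified with its Taylor series at the origin. Then $\mathfrak F^\Delta(S)=\mathfrak{Rat}(S)$ if and only if $S$ is strongly non-degenerate, i.e. every $(d+1)$-element subset of $S$ is spanning. -/

import Mathlib

open MeasureTheory
open scoped Nat

noncomputable section

namespace FantappieSimplex

/-- `ℝ^d` with its standard scalar product and Lebesgue measure. -/
abbrev Space (d : ℕ) : Type := EuclideanSpace ℝ (Fin d)

variable {d : ℕ}

/-- A finite set of points of `ℝ^d` is spanning if it lies in no affine hyperplane, that is, if its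
affine span is the whole space. -/
def IsSpanning (S : Finset (Space d)) : Prop :=
  affineSpan ℝ (S : Set (Space d)) = ⊤

/-- Every `(d+1)`-element subset of `S` is spanning. -/
def StronglyNondegenerate (S : Finset (Space d)) : Prop :=
  ∀ T : Finset (Space d), T ⊆ S → T.card = d + 1 → IsSpanning T

instance isFiniteMeasure_restrict_convexHull (T : Finset (Space d)) :
    IsFiniteMeasure (volume.restrict (convexHull ℝ (T : Set (Space d)))) :=
  isFiniteMeasure_restrict.2 (T.finite_toSet.isCompact_convexHull ℝ).measure_lt_top.ne

/-- The standard measure `χ_{conv T} dx` of the convex hull of a finite set `T`, as a signed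
measure. -/
def standardMeasure (T : Finset (Space d)) : SignedMeasure (Space d) :=
  (volume.restrict (convexHull ℝ (T : Set (Space d)))).toSignedMeasure

/-- The real linear span of the standard measures of all `d`-dimensional simplices with vertices in
`S`; such a simplex is the convex hull of a spanning `(d+1)`-element subset of `S`. -/
def simplexMeasures (S : Finset (Space d)) : Submodule ℝ (SignedMeasure (Space d)) :=
  Submodule.span ℝ
    {μ | ∃ T : Finset (Space d), T ⊆ S ∧ T.card = d + 1 ∧ IsSpanning T ∧ μ = standardMeasure T}

/-- The moment `m_I(μ) = ∫ x^I dμ(x)` of a signed measure. -/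
def moment (I : Fin d →₀ ℕ) (μ : SignedMeasure (Space d)) : ℝ :=
  ∫ᵛ x, ∏ i, x i ^ I i ∂<•μ

/-- The normalized moment generating function (Fantappiè transform)
`F_μ(u) = ∑_I (|I| + d)! / (i_1! ⋯ i_d!) m_I(μ) u^I`, a power series in `u_1, …, u_d`. -/
def fantappie (μ : SignedMeasure (Space d)) : MvPowerSeries (Fin d) ℝ :=
  fun I => (((∑ i, I i) + d)! : ℝ) / (∏ i, ((I i)! : ℝ)) * moment I μ

/-- The Fantappiè transforms of the measures in `simplexMeasures S`. -/
def fantappieSpace (S : Finset (Space d)) : Set (MvPowerSeries (Fin d) ℝ) :=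
  fantappie '' (simplexMeasures S : Set (SignedMeasure (Space d)))

/-- The polynomial `1 - ⟨v, u⟩` in the variables `u_1, …, u_d`. -/
def dualForm (v : Space d) : MvPolynomial (Fin d) ℝ :=
  1 - ∑ i, MvPolynomial.C (v i) * MvPolynomial.X i

/-- `Φ_S(u) = ∏_{v ∈ S} (1 - ⟨v, u⟩)`. -/
def denominator (S : Finset (Space d)) : MvPolynomial (Fin d) ℝ :=
  ∏ v ∈ S, dualForm v

/-- The rational functions `P / Φ_S` with `P` a real polynomial of degree at most `#S - d - 1`.
As `Φ_S` has constant term `1`, it is invertible as a power series, and a rational function with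
this denominator is identified with its Taylor expansion at the origin. For a spanning set
`d + 1 ≤ #S`, so that the subtraction does not truncate. -/
def ratSpace (S : Finset (Space d)) : Set (MvPowerSeries (Fin d) ℝ) :=
  {R | ∃ P : MvPolynomial (Fin d) ℝ, P.totalDegree ≤ S.card - d - 1 ∧
    R = (P : MvPowerSeries (Fin d) ℝ) * (denominator S : MvPowerSeries (Fin d) ℝ)⁻¹}

end FantappieSimplex

end

namespace FantappieSimplex

open MvPolynomial

variable {d : ℕ}

/-! The transform of a simplex with vertex set `T` is a nonzero constant divided by the product of
the forms `1 - ⟨v, u⟩`, `v ∈ T` (`fantappie_standardMeasure`). Over the common denominator `Φ_S` its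
numerator is the product of the forms of `S \ T`. Division by `Φ_S` is injective, so the theorem
becomes a statement on polynomials: these products span everything of degree at most `k = #S - d -
1` exactly when `S` is strongly non-degenerate (`coe_complementProducts_eq_iff`).

If `S` is strongly non-degenerate, induct on `k`: the forms of any `d + 1` points of `S` span `1,
u_1, …, u_d`, and each form `1 - ⟨v, u⟩` times a product for `S` without `v` is a product for `S`.

Conversely, let `d + 1` points of `S` lie on a hyperplane `⟨x, b⟩ = a`. The complement of every
spanning `T` contains one of them. If `a ≠ 0`, all products vanish at `u = b / a`, but the constant
`1` does not. If `a = 0`, that point's form is `1` on the line through `b`, so the products have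
degree below `k` there, unlike `⟨b, u⟩ ^ k`. -/

/-- The span of the products of the dual forms of the complements in `S` of the simplices with
vertices in `S`. -/
noncomputable def complementProducts (S : Finset (Space d)) : Submodule ℝ (MvPolynomial (Fin d) ℝ) :=
  Submodule.span ℝ {p | ∃ T : Finset (Space d), T ⊆ S ∧ T.card = d + 1 ∧ IsSpanning T ∧
    p = denominator (S \ T)}

/-! ### Complement products of a strongly non-degenerate set. -/

lemma totalDegree_dualForm_le (v : Space d) : (dualForm v).totalDegree ≤ 1 := by
  unfold dualForm
  refine (totalDegree_sub _ _).trans (max_le (by simp) ?_)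
  refine totalDegree_finsetSum_le fun i _ => (totalDegree_mul _ _).trans ?_
  simp

lemma totalDegree_denominator_le (S : Finset (Space d)) :
    (denominator S).totalDegree ≤ S.card := by
  refine (totalDegree_finsetProd _ _).trans ?_
  simpa using Finset.sum_le_card_nsmul S _ 1 fun v _ => totalDegree_dualForm_le v

lemma complementProducts_le (S : Finset (Space d)) :
    complementProducts S ≤ restrictTotalDegree (Fin d) ℝ (S.card - d - 1) := by
  refine Submodule.span_le.2 ?_
  rintro p ⟨T, hT, hc, -, rfl⟩
  simp only [SetLike.mem_coe, mem_restrictTotalDegree]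
  have := totalDegree_denominator_le (S \ T)
  rw [Finset.card_sdiff_of_subset hT, hc] at this
  omega

/-- The map `v ↦ 1 - ⟨v, u⟩` is affine, so it carries affine combinations of points to linear
combinations of forms. -/
lemma dualForm_mem_span {T : Finset (Space d)} (hT : IsSpanning T) (x : Space d) :
    dualForm x ∈ Submodule.span ℝ (dualForm '' (T : Set (Space d))) := by
  have hx : x ∈ affineSpan ℝ (T : Set (Space d)) := by rw [hT]; trivial
  refine affineSpan_induction hx (fun v hv => Submodule.subset_span ⟨v, hv, rfl⟩) ?_
  intro c u v w hu hv hw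
  have : dualForm (c • (u -ᵥ v) +ᵥ w) = c • (dualForm u - dualForm v) + dualForm w := by
    simp only [dualForm, vsub_eq_sub, vadd_eq_add, PiLp.add_apply, PiLp.smul_apply,
      PiLp.sub_apply, smul_eq_mul, map_add, map_mul, map_sub, smul_eq_C_mul, add_mul, mul_assoc,
      sub_mul, Finset.sum_add_distrib, ← Finset.mul_sum, Finset.sum_sub_distrib]
    ring
  rw [this]
  exact add_mem (Submodule.smul_mem _ _ (sub_mem hu hv)) hw

lemma dualForm_zero : dualForm (0 : Space d) = 1 := by simp [dualForm]

lemma one_mem_span_dualForm {T : Finset (Space d)} (hT : IsSpanning T) :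
    (1 : MvPolynomial (Fin d) ℝ) ∈ Submodule.span ℝ (dualForm '' (T : Set (Space d))) := by
  simpa [dualForm_zero] using dualForm_mem_span hT 0

lemma X_mem_span_dualForm {T : Finset (Space d)} (hT : IsSpanning T) (i : Fin d) :
    (X i : MvPolynomial (Fin d) ℝ) ∈ Submodule.span ℝ (dualForm '' (T : Set (Space d))) := by
  have h : (X i : MvPolynomial (Fin d) ℝ) = 1 - dualForm (EuclideanSpace.single i (1 : ℝ)) := by
    rw [dualForm, sub_sub_cancel, Finset.sum_eq_single i] <;> simp +contextual
  rw [h]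
  exact sub_mem (one_mem_span_dualForm hT) (dualForm_mem_span hT _)

lemma dualForm_mul_mem_complementProducts {S : Finset (Space d)} {v : Space d} (hv : v ∈ S)
    {q : MvPolynomial (Fin d) ℝ} (hq : q ∈ complementProducts (S.erase v)) :
    dualForm v * q ∈ complementProducts S := by
  induction hq using Submodule.span_induction with
  | mem p hp =>
    obtain ⟨T, hT, hc, hs, rfl⟩ := hp
    refine Submodule.subset_span ⟨T, hT.trans (Finset.erase_subset _ _), hc, hs, ?_⟩
    have hvT : v ∉ T := fun h => by simpa using hT h
    rw [denominator, denominator, Finset.erase_sdiff_comm]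
    exact Finset.mul_prod_erase (S \ T) dualForm (by simp [hv, hvT])
  | zero => simp
  | add x y _ _ hx hy => rw [mul_add]; exact add_mem hx hy
  | smul c x _ hx => rw [mul_smul_comm]; exact Submodule.smul_mem _ _ hx

lemma mem_complementProducts_of_totalDegree_le (k : ℕ) :
    ∀ S : Finset (Space d), S.card = k + (d + 1) → StronglyNondegenerate S →
      ∀ P : MvPolynomial (Fin d) ℝ, P.totalDegree ≤ k → P ∈ complementProducts S := by
  induction k with
  | zero =>
    intro S hc hS P hP
    rw [Nat.le_zero, totalDegree_eq_zero_iff_eq_C] at hP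
    rw [hP, ← mul_one (C _), ← smul_eq_C_mul]
    refine Submodule.smul_mem _ _ (Submodule.subset_span ⟨S, le_rfl, by omega,
      hS S le_rfl (by omega), by simp [denominator]⟩)
  | succ k ih =>
    intro S hc hS P hP
    obtain ⟨T, hTS, hT⟩ := Finset.exists_subset_card_eq (show d + 1 ≤ S.card by omega)
    have hTs := hS T hTS hT
    have key : ∀ y ∈ Submodule.span ℝ (dualForm '' (T : Set (Space d))),
        ∀ q : MvPolynomial (Fin d) ℝ, q.totalDegree ≤ k → y * q ∈ complementProducts S := by
      intro y hy q hq
      induction hy using Submodule.span_induction with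
      | mem y hy =>
        obtain ⟨v, hv, rfl⟩ := hy
        have hvS := hTS hv
        refine dualForm_mul_mem_complementProducts hvS (ih _ ?_ ?_ q hq)
        · rw [Finset.card_erase_of_mem hvS]; omega
        · exact fun T' hT' => hS T' (hT'.trans (Finset.erase_subset _ _))
      | zero => simp
      | add x y _ _ hx hy => rw [add_mul]; exact add_mem hx hy
      | smul c x _ hx => rw [smul_mul_assoc]; exact Submodule.smul_mem _ _ hx
    rw [P.as_sum]
    refine Submodule.sum_mem _ fun m hm => ?_
    have hmd : m.degree ≤ k + 1 := (le_totalDegree hm).trans hP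
    by_cases h0 : m = 0
    -- The factor from the span is `1` for the constant term, and a variable `X i` dividing the
    -- monomial otherwise; the cofactor then has degree at most `k`.
    · rw [h0, ← one_mul (monomial _ _)]
      exact key 1 (one_mem_span_dualForm hTs) _ (by simp)
    · obtain ⟨i, hi⟩ := Finsupp.ne_iff.1 h0
      have hi1 : Finsupp.single i 1 ≤ m := by
        simpa [Nat.one_le_iff_ne_zero] using hi
      have hmi : m = Finsupp.single i 1 + (m - Finsupp.single i 1) :=
        (add_tsub_cancel_of_le hi1).symm
      rw [hmi, ← one_mul (coeff _ P), ← monomial_mul]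
      refine key _ (X_mem_span_dualForm hTs i) _ ((totalDegree_monomial_le _ _).trans ?_)
      have := congrArg Finsupp.degree hmi
      rw [map_add, Finsupp.degree_single] at this
      change Finsupp.degree _ ≤ k
      omega

/-! ### Complement products of a degenerate set. -/

lemma exists_hyperplane {T : Finset (Space d)} (hT : T.Nonempty) (h : ¬ IsSpanning T) :
    ∃ b : Fin d → ℝ, b ≠ 0 ∧ ∃ a : ℝ, ∀ v ∈ T, ∑ i, v i * b i = a := by
  obtain ⟨v₀, hv₀⟩ := hT
  have hne : (affineSpan ℝ (T : Set (Space d))).direction < ⊤ := by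
    refine lt_top_iff_ne_top.2 fun htop => h ?_
    exact (AffineSubspace.direction_eq_top_iff_of_nonempty
      ⟨v₀, subset_affineSpan ℝ _ hv₀⟩).1 htop
  obtain ⟨f, hf0, hf⟩ := Submodule.exists_le_ker_of_lt_top _ hne
  have hfx : ∀ x : Space d, f x = ∑ i, x i * f (EuclideanSpace.single i 1) := by
    intro x
    conv_lhs => rw [← (EuclideanSpace.basisFun (Fin d) ℝ).sum_repr x]
    simp
  refine ⟨fun i => f (EuclideanSpace.single i 1), fun hb => hf0 ?_, f v₀, fun v hv => ?_⟩
  · ext x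
    rw [hfx]
    exact Finset.sum_eq_zero fun i _ => by simp [congrFun hb i]
  · rw [← hfx]
    have := hf (AffineSubspace.vsub_mem_direction (subset_affineSpan ℝ _ hv)
      (subset_affineSpan ℝ _ hv₀))
    rw [LinearMap.mem_ker, vsub_eq_sub, map_sub] at this
    exact sub_eq_zero.1 this

/-- Applied with `T₀` degenerate and `T` spanning, it yields a factor of the complement product of
`T` coming from a point of `T₀`. -/
lemma exists_mem_sdiff_of_card_eq {α : Type*} [DecidableEq α] {S T T₀ : Finset α} (hT₀ : T₀ ⊆ S)
    (hc : T.card = T₀.card) (hne : T ≠ T₀) : ∃ v ∈ T₀, v ∈ S \ T := by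
  have : ¬ T₀ ⊆ T := fun h => hne (Finset.eq_of_subset_of_card_le h hc.le).symm
  obtain ⟨v, hv, hvT⟩ := Finset.not_subset.1 this
  exact ⟨v, hv, Finset.mem_sdiff.2 ⟨hT₀ hv, hvT⟩⟩

lemma exists_notMem_complementProducts {S T₀ : Finset (Space d)} (hT₀ : T₀ ⊆ S)
    (hc : T₀.card = d + 1) (h : ¬ IsSpanning T₀) :
    ∃ P : MvPolynomial (Fin d) ℝ, P.totalDegree ≤ S.card - d - 1 ∧
      P ∉ complementProducts S := by
  obtain ⟨b, hb, a, hab⟩ := exists_hyperplane (Finset.card_pos.1 (by omega)) h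
  set k := S.card - d - 1 with hk
  by_cases ha : a = 0
  -- `ψ` restricts a polynomial to the line `u = t b`; the obstruction is the coefficient of `t ^
  -- k`.
  · let ψ : MvPolynomial (Fin d) ℝ →ₐ[ℝ] Polynomial ℝ :=
      aeval fun i => Polynomial.C (b i) * Polynomial.X
    have hψ : ∀ v : Space d,
        ψ (dualForm v) = 1 - Polynomial.C (∑ i, v i * b i) * Polynomial.X := by
      intro v
      simp [ψ, dualForm, Finset.sum_mul, mul_assoc, Polynomial.algebraMap_eq]
    have hdeg : ∀ v : Space d, (ψ (dualForm v)).natDegree ≤ 1 := by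
      intro v
      rw [hψ]
      compute_degree
    refine ⟨(∑ i, C (b i) * X i) ^ k, ?_, fun hmem => ?_⟩
    · refine (totalDegree_pow _ _).trans ?_
      have : (∑ i, C (b i) * X i : MvPolynomial (Fin d) ℝ).totalDegree ≤ 1 :=
        totalDegree_finsetSum_le fun i _ => (totalDegree_mul _ _).trans (by simp)
      simpa using Nat.mul_le_mul_left k this
    have hz : ∀ p ∈ complementProducts S, (ψ p).coeff k = 0 := by
      intro p hp
      induction hp using Submodule.span_induction with
      | mem p hp =>
        obtain ⟨T, hT, hTc, hs, rfl⟩ := hp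
        obtain ⟨v, hv, hvT⟩ := exists_mem_sdiff_of_card_eq hT₀ (hTc.trans hc.symm)
          (by rintro rfl; exact h hs)
        rw [denominator, ← Finset.mul_prod_erase _ _ hvT, map_mul, hψ, hab v hv, ha]
        simp only [map_zero, zero_mul, sub_zero, one_mul, map_prod]
        refine Polynomial.coeff_eq_zero_of_natDegree_lt
          ((Polynomial.natDegree_prod_le _ _).trans_lt ?_)
        have h1 := Finset.sum_le_card_nsmul ((S \ T).erase v)
          (fun w => (ψ (dualForm w)).natDegree) 1 fun w _ => hdeg w
        rw [Finset.card_erase_of_mem hvT, Finset.card_sdiff_of_subset hT, hTc] at h1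
        -- As `S \ T` is nonempty, `k ≥ 1`, so losing one factor brings the degree strictly below
        -- `k`.
        have h2 := Finset.card_pos.2 ⟨v, hvT⟩
        rw [Finset.card_sdiff_of_subset hT, hTc] at h2
        simp only [smul_eq_mul, mul_one] at h1
        omega
      | zero => simp
      | add x y _ _ hx hy => simp [hx, hy]
      | smul c x _ hx => simp [hx]
    have h1 := hz _ hmem
    have h2 : ψ ((∑ i, C (b i) * X i) ^ k) =
        Polynomial.C ((∑ i, b i * b i) ^ k) * Polynomial.X ^ k := by
      simp [ψ, Finset.sum_mul, mul_assoc, Polynomial.algebraMap_eq, ← mul_pow]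
    rw [h2, Polynomial.coeff_C_mul, Polynomial.coeff_X_pow_self, mul_one] at h1
    have h3 := eq_zero_of_pow_eq_zero h1
    rw [Finset.sum_eq_zero_iff_of_nonneg fun i _ => mul_self_nonneg _] at h3
    exact hb (funext fun i => mul_self_eq_zero.1 (h3 i (Finset.mem_univ _)))
  · refine ⟨1, by simp, fun hmem => ?_⟩
    have hz : ∀ p ∈ complementProducts S, eval (fun i => b i / a) p = 0 := by
      intro p hp
      induction hp using Submodule.span_induction with
      | mem p hp =>
        obtain ⟨T, hT, hTc, hs, rfl⟩ := hp
        obtain ⟨v, hv, hvT⟩ := exists_mem_sdiff_of_card_eq hT₀ (hTc.trans hc.symm)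
          (by rintro rfl; exact h hs)
        rw [denominator, map_prod]
        refine Finset.prod_eq_zero hvT ?_
        simp [dualForm, ← mul_div_assoc, ← Finset.sum_div, hab v hv, ha]
      | zero => simp
      | add x y _ _ hx hy => simp [hx, hy]
      | smul c x _ hx => simp [hx]
    simpa using hz _ hmem

/-- Ensures that `S.card - d - 1` is not truncated. -/
lemma IsSpanning.lt_card {S : Finset (Space d)} (hS : IsSpanning S) : d < S.card := by
  have hne : S.Nonempty := by
    rw [Finset.nonempty_iff_ne_empty]
    rintro rfl
    have h : affineSpan ℝ ((∅ : Finset (Space d)) : Set (Space d)) = ⊤ := hS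
    rw [Finset.coe_empty, AffineSubspace.span_empty] at h
    exact AffineSubspace.bot_ne_top ℝ (Space d) (Space d) h
  have h := finrank_vectorSpan_image_finset_le ℝ (id : Space d → Space d) S
    (n := S.card - 1) (by have := hne.card_pos; omega)
  rw [Finset.image_id, ← direction_affineSpan, show affineSpan ℝ (S : Set (Space d)) = ⊤ from hS,
    AffineSubspace.direction_top, finrank_top, finrank_euclideanSpace_fin] at h
  have := hne.card_pos
  omega

lemma coe_complementProducts_eq_iff {S : Finset (Space d)} (hS : IsSpanning S) :
    (complementProducts S : Set (MvPolynomial (Fin d) ℝ)) =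
      {P | P.totalDegree ≤ S.card - d - 1} ↔ StronglyNondegenerate S := by
  constructor
  · intro h T hT hc
    by_contra hns
    obtain ⟨P, hP, hPn⟩ := exists_notMem_complementProducts hT hc hns
    exact hPn (h.symm.subset hP)
  · intro h
    have hcard := hS.lt_card
    refine Set.Subset.antisymm (fun p hp => ?_) fun P hP => ?_
    · simpa [mem_restrictTotalDegree] using complementProducts_le S hp
    · exact mem_complementProducts_of_totalDegree_le _ S (by omega) h P hP

/-! ### Dirichlet's integral. -/

/-- The corner simplex `{t ≥ 0, ∑ t_i ≤ s}`. -/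
def cornerSimplex (n : ℕ) (s : ℝ) : Set (Fin n → ℝ) := {t | (∀ i, 0 ≤ t i) ∧ ∑ i, t i ≤ s}

lemma isClosed_cornerSimplex (n : ℕ) (s : ℝ) : IsClosed (cornerSimplex n s) := by
  have : cornerSimplex n s = (⋂ i, {t | 0 ≤ t i}) ∩ {t | ∑ i, t i ≤ s} := by
    ext; simp [cornerSimplex]
  rw [this]
  exact (isClosed_iInter fun i => isClosed_le continuous_const (continuous_apply i)).inter
    (isClosed_le (by fun_prop) continuous_const)

lemma isCompact_cornerSimplex (n : ℕ) (s : ℝ) : IsCompact (cornerSimplex n s) := by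
  refine (isCompact_Icc (a := (0 : Fin n → ℝ)) (b := fun _ => s)).of_isClosed_subset
    (isClosed_cornerSimplex n s) fun t ht => ⟨ht.1, fun i => ?_⟩
  exact (Finset.single_le_sum (fun j _ => ht.1 j) (Finset.mem_univ i)).trans ht.2

/-- Integration by parts trades a power of `s - x` for a power of `x`; the boundary terms vanish. -/
lemma integral_pow_mul_sub_pow (s : ℝ) (m : ℕ) : ∀ a : ℕ,
    ∫ x in (0 : ℝ)..s, x ^ a * (s - x) ^ m = a ! * m ! / (a + m + 1)! * s ^ (a + m + 1) := by
  induction m with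
  | zero =>
    intro a
    simp only [pow_zero, mul_one, integral_pow, add_zero, Nat.factorial_zero, Nat.cast_one,
      Nat.factorial_succ]
    push_cast
    field_simp
    simp
  | succ m ih =>
    intro a
    have hd : ∀ x ∈ Set.uIcc 0 s, HasDerivAt (fun x => x ^ (a + 1) * (s - x) ^ (m + 1))
        ((a + 1 : ℝ) * (x ^ a * (s - x) ^ (m + 1)) - (m + 1 : ℝ) * (x ^ (a + 1) * (s - x) ^ m))
        x := by
      intro x _
      convert! (hasDerivAt_pow (a + 1) x).mul (((hasDerivAt_id x).const_sub s).pow (m + 1)) using 1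
      simp
      ring
    have h := intervalIntegral.integral_eq_sub_of_hasDerivAt hd
      (Continuous.intervalIntegrable (by fun_prop) _ _)
    rw [intervalIntegral.integral_sub (Continuous.intervalIntegrable (by fun_prop) _ _)
      (Continuous.intervalIntegrable (by fun_prop) _ _), intervalIntegral.integral_const_mul,
      intervalIntegral.integral_const_mul, ih (a + 1)] at h
    simp only [ne_eq, Nat.add_eq_zero_iff, one_ne_zero, and_false, not_false_eq_true, zero_pow,
      sub_self, mul_zero, zero_mul] at h
    have ha : (a + 1 : ℝ) ≠ 0 := by positivity
    apply mul_left_cancel₀ ha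
    rw [sub_eq_zero.1 h, show a + 1 + m + 1 = a + (m + 1) + 1 by ring, Nat.factorial_succ a,
      Nat.factorial_succ m]
    push_cast
    ring

lemma cons_mem_cornerSimplex {n : ℕ} {s x : ℝ} {y : Fin n → ℝ} :
    (Fin.cons x y : Fin (n + 1) → ℝ) ∈ cornerSimplex (n + 1) s ↔
      0 ≤ x ∧ y ∈ cornerSimplex n (s - x) := by
  simp only [cornerSimplex, Set.mem_ofPred_eq, Fin.forall_fin_succ, Fin.cons_zero, Fin.cons_succ,
    Fin.sum_univ_succ, le_sub_iff_add_le', and_assoc]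

lemma integral_fin_succ {n : ℕ} {f : (Fin (n + 1) → ℝ) → ℝ} (hf : Integrable f) :
    ∫ t, f t = ∫ x : ℝ, ∫ y : Fin n → ℝ, f (Fin.cons x y) := by
  have he := (volume_preserving_piFinSuccAbove (fun _ : Fin (n + 1) => ℝ) 0).symm
  have hc : ∀ z : ℝ × (Fin n → ℝ),
      (MeasurableEquiv.piFinSuccAbove (fun _ : Fin (n + 1) => ℝ) 0).symm z =
        Fin.cons z.1 z.2 := by
    intro z
    simp [MeasurableEquiv.piFinSuccAbove, Fin.insertNthEquiv]
  rw [← he.integral_comp', Measure.volume_eq_prod, integral_prod]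
  · simp only [hc]
  · exact (he.integrable_comp_emb (MeasurableEquiv.measurableEmbedding _)).2 hf

/-- **Dirichlet's integral** over the corner simplex. -/
lemma integral_cornerSimplex (n : ℕ) : ∀ (a : Fin n → ℕ) (b : ℕ) (s : ℝ), 0 ≤ s →
    ∫ t in cornerSimplex n s, (∏ i, t i ^ a i) * (s - ∑ i, t i) ^ b =
      (∏ i, ((a i)! : ℝ)) * b ! / (∑ i, a i + b + n)! * s ^ (∑ i, a i + b + n) := by
  induction n with
  | zero =>
    intro a b s hs
    have : cornerSimplex 0 s = Set.univ := by ext; simp [cornerSimplex, hs]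
    rw [this, setIntegral_univ]
    simp [Measure.volume_pi_eq_dirac default]
    field_simp
  | succ n ih =>
    intro a b s hs
    have hint : ∀ (n : ℕ) (a : Fin n → ℕ) (s : ℝ), Integrable ((cornerSimplex n s).indicator
        fun t => (∏ i, t i ^ a i) * (s - ∑ i, t i) ^ b) := by
      intro n a s
      refine IntegrableOn.integrable_indicator ?_ (isClosed_cornerSimplex n s).measurableSet
      exact ContinuousOn.integrableOn_compact (isCompact_cornerSimplex n s) (by fun_prop)
    rw [← integral_indicator (isClosed_cornerSimplex _ s).measurableSet,
      integral_fin_succ (hint _ _ _)]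
    set M := ∑ i : Fin n, a i.succ + b + n with hM
    set K : ℝ := (∏ i, ((a (Fin.succ i))! : ℝ)) * b ! / M ! with hK
    -- The slice with first coordinate `x` is the corner simplex of size `s - x`, so the inner
    -- integral is a constant times `(s - x) ^ M`.
    have hinner : ∀ x : ℝ, ∫ y : Fin n → ℝ, (cornerSimplex (n + 1) s).indicator
        (fun t => (∏ i, t i ^ a i) * (s - ∑ i, t i) ^ b) (Fin.cons x y) =
        (Set.Icc 0 s).indicator (fun x => K * (x ^ a 0 * (s - x) ^ M)) x := by
      intro x
      by_cases hx : x ∈ Set.Icc 0 s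
      · rw [Set.indicator_of_mem hx]
        have := ih (fun i => a i.succ) b (s - x) (sub_nonneg.2 hx.2)
        rw [← integral_indicator (isClosed_cornerSimplex _ _).measurableSet] at this
        calc _ = ∫ y, x ^ a 0 * (cornerSimplex n (s - x)).indicator
              (fun t => (∏ i, t i ^ a (Fin.succ i)) * (s - x - ∑ i, t i) ^ b) y := by
              congr 1
              ext y
              by_cases hy : y ∈ cornerSimplex n (s - x)
              · rw [Set.indicator_of_mem hy,
                  Set.indicator_of_mem (cons_mem_cornerSimplex.2 ⟨hx.1, hy⟩)]
                simp [Fin.prod_univ_succ, Fin.sum_univ_succ, mul_assoc, sub_sub]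
              · rw [Set.indicator_of_notMem hy, Set.indicator_of_notMem
                  fun h => hy (cons_mem_cornerSimplex.1 h).2, mul_zero]
          _ = _ := by rw [integral_const_mul, this]; ring
      · rw [Set.indicator_of_notMem hx]
        refine integral_eq_zero_of_ae (Filter.Eventually.of_forall fun y => ?_)
        refine Set.indicator_of_notMem (fun h => hx ?_) _
        obtain ⟨h0, h1⟩ := cons_mem_cornerSimplex.1 h
        exact ⟨h0, sub_nonneg.1 ((Finset.sum_nonneg fun i _ => h1.1 i).trans h1.2)⟩
    simp_rw [hinner]
    rw [integral_indicator measurableSet_Icc, integral_Icc_eq_integral_Ioc,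
      ← intervalIntegral.integral_of_le hs, intervalIntegral.integral_const_mul,
      integral_pow_mul_sub_pow, Fin.prod_univ_succ, Fin.sum_univ_succ,
      show a 0 + ∑ i : Fin n, a i.succ + b + (n + 1) = a 0 + M + 1 by rw [hM]; ring, hK]
    have : (M ! : ℝ) ≠ 0 := by positivity
    field_simp

/-! ### Inverting products of forms `1 - L` degree by degree. -/

section GradedSeries

variable {σ R : Type*} [CommRing R]

/-- The power series whose part of degree `n` is that of `p n`. -/
noncomputable def gradedSeries (p : ℕ → MvPolynomial σ R) : MvPowerSeries σ R :=
  fun I => coeff I (p I.degree)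

lemma coeff_gradedSeries (p : ℕ → MvPolynomial σ R) (I : σ →₀ ℕ) :
    MvPowerSeries.coeff I (gradedSeries p) = coeff I (p I.degree) := rfl

lemma gradedSeries_mul {p q : ℕ → MvPolynomial σ R} (hp : ∀ n, (p n).IsHomogeneous n)
    (hq : ∀ n, (q n).IsHomogeneous n) :
    gradedSeries p * gradedSeries q =
      gradedSeries fun n => ∑ x ∈ Finset.HasAntidiagonal.antidiagonal n, p x.1 * q x.2 := by
  classical
  ext I
  simp only [MvPowerSeries.coeff_mul, coeff_gradedSeries, coeff_sum, MvPolynomial.coeff_mul]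
  rw [Finset.sum_comm]
  refine Finset.sum_congr rfl fun x hx => ?_
  rw [Finset.HasAntidiagonal.mem_antidiagonal] at hx
  rw [Finset.sum_eq_single (x.1.degree, x.2.degree)]
  · rintro ⟨a, b⟩ - hab
    by_cases ha : x.1.degree = a
    · have hb : x.2.degree ≠ b := fun h => hab (by rw [ha, h])
      rw [(hq b).coeff_eq_zero hb, mul_zero]
    · rw [(hp a).coeff_eq_zero ha, zero_mul]
  · intro h
    exact absurd (by rw [Finset.HasAntidiagonal.mem_antidiagonal, ← hx, map_add]) h

lemma gradedSeries_one : gradedSeries (fun n => if n = 0 then (1 : MvPolynomial σ R) else 0) = 1 := by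
  classical
  ext I
  rw [coeff_gradedSeries, MvPowerSeries.coeff_one]
  by_cases hI : I = 0
  · simp [hI]
  · simp [hI, Finsupp.degree_eq_zero_iff]

lemma coe_one_sub_eq_gradedSeries {L : MvPolynomial σ R} (hL : L.IsHomogeneous 1) :
    ((1 - L : MvPolynomial σ R) : MvPowerSeries σ R) =
      gradedSeries fun n => if n = 0 then 1 else if n = 1 then -L else 0 := by
  classical
  ext I
  rw [coeff_gradedSeries, MvPolynomial.coeff_coe, coeff_sub, coeff_one]
  by_cases hI : I = 0
  · simp [hI, hL.coeff_eq_zero (d := 0) (by simp)]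
  · rw [if_neg (Ne.symm hI), if_neg (by simpa [Finsupp.degree_eq_zero_iff] using hI)]
    split_ifs with h
    · simp
    · simp [hL.coeff_eq_zero h]

/-- The geometric series of `L`. -/
lemma gradedSeries_pow_mul_one_sub {L : MvPolynomial σ R} (hL : L.IsHomogeneous 1) :
    gradedSeries (fun n => L ^ n) * ((1 - L : MvPolynomial σ R) : MvPowerSeries σ R) = 1 := by
  rw [coe_one_sub_eq_gradedSeries hL, gradedSeries_mul (fun n => by simpa using hL.pow n),
    ← gradedSeries_one]
  · congr 1
    ext1 n
    rcases n with _ | n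
    · simp
    · rw [Finset.Nat.sum_antidiagonal_succ', if_neg n.succ_ne_zero]
      rcases n with _ | n
      · simp
      · rw [Finset.Nat.sum_antidiagonal_succ']
        simp
        ring
  · intro n
    split_ifs with h0 h1
    · exact h0 ▸ isHomogeneous_one _ _
    · exact h1 ▸ hL.neg
    · exact isHomogeneous_zero _ _ _

lemma isHomogeneous_sum_piAntidiag {ι : Type*} [DecidableEq ι] {L : ι → MvPolynomial σ R}
    (hL : ∀ j, (L j).IsHomogeneous 1) (s : Finset ι) (n : ℕ) :
    (∑ α ∈ s.piAntidiag n, ∏ j ∈ s, L j ^ α j).IsHomogeneous n := by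
  refine IsHomogeneous.sum _ _ _ fun α hα => ?_
  rw [← (Finset.mem_piAntidiag.1 hα).1]
  exact IsHomogeneous.prod _ _ _ fun j _ => by simpa using (hL j).pow (α j)

/-- The product of the geometric series of the `L j` has as its degree `n` part the complete
homogeneous polynomial in the `L j`; splitting off the exponent of one index is a Cauchy product. -/
lemma gradedSeries_piAntidiag_mul_prod {ι : Type*} [DecidableEq ι] {L : ι → MvPolynomial σ R}
    (hL : ∀ j, (L j).IsHomogeneous 1) (s : Finset ι) :
    gradedSeries (fun n => ∑ α ∈ s.piAntidiag n, ∏ j ∈ s, L j ^ α j) *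
      ((∏ j ∈ s, (1 - L j) : MvPolynomial σ R) : MvPowerSeries σ R) = 1 := by
  induction s using Finset.cons_induction with
  | empty =>
    rw [Finset.prod_empty, MvPolynomial.coe_one, mul_one, ← gradedSeries_one]
    congr 1
    ext1 n
    rw [Finset.piAntidiag_empty]
    split_ifs <;> simp
  | cons i s hi ih =>
    have : gradedSeries (fun n => ∑ α ∈ (Finset.cons i s hi).piAntidiag n,
        ∏ j ∈ Finset.cons i s hi, L j ^ α j) =
        gradedSeries (fun n => L i ^ n) *
          gradedSeries (fun n => ∑ α ∈ s.piAntidiag n, ∏ j ∈ s, L j ^ α j) := by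
      rw [gradedSeries_mul (fun n => by simpa using (hL i).pow n)
        (isHomogeneous_sum_piAntidiag hL s)]
      congr 1
      ext1 n
      rw [Finset.piAntidiag_cons, Finset.sum_disjiUnion]
      refine Finset.sum_congr rfl fun x _ => ?_
      rw [Finset.sum_map, Finset.mul_sum]
      refine Finset.sum_congr rfl fun α hα => ?_
      have hαi : α i = 0 := by
        by_contra h
        exact hi ((Finset.mem_piAntidiag.1 hα).2 i h)
      rw [Finset.prod_cons]
      simp only [addRightEmbedding_apply, Pi.add_apply, if_true, hαi, zero_add]
      congr 1
      refine Finset.prod_congr rfl fun j hj => ?_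
      rw [if_neg (by rintro rfl; exact hi hj), add_zero]
    rw [this, Finset.prod_cons, MvPolynomial.coe_mul, mul_mul_mul_comm,
      gradedSeries_pow_mul_one_sub (hL i), ih, one_mul]

end GradedSeries

/-! ### Integration over a simplex in barycentric coordinates. -/

section SimplexIntegral

/-- The barycentric coordinates `(1 - ∑ t_i, t_1, …, t_d)` of a point of the corner simplex. -/
def barycentric (t : Fin d → ℝ) : Fin (d + 1) → ℝ := Fin.cons (1 - ∑ i, t i) t

lemma barycentric_nonneg {t : Fin d → ℝ} (ht : t ∈ cornerSimplex d 1) (j : Fin (d + 1)) :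
    0 ≤ barycentric t j := by
  refine Fin.cases ?_ (fun i => ?_) j
  · simpa [barycentric] using ht.2
  · simpa [barycentric] using ht.1 i

lemma sum_barycentric (t : Fin d → ℝ) : ∑ j, barycentric t j = 1 := by
  simp [barycentric, Fin.sum_univ_succ]

@[fun_prop]
lemma continuous_barycentric (j : Fin (d + 1)) :
    Continuous fun t : Fin d → ℝ => barycentric t j := by
  refine Fin.cases ?_ (fun i => ?_) j
  · simp only [barycentric, Fin.cons_zero]; fun_prop
  · simp only [barycentric, Fin.cons_succ]; fun_prop

lemma convex_cornerSimplex (n : ℕ) (s : ℝ) : Convex ℝ (cornerSimplex n s) := by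
  rintro x ⟨hx, hxs⟩ y ⟨hy, hys⟩ a b ha hb hab
  refine ⟨fun i => ?_, ?_⟩
  · have := hx i
    have := hy i
    simp only [Pi.add_apply, Pi.smul_apply, smul_eq_mul]
    positivity
  · simp only [Pi.add_apply, Pi.smul_apply, smul_eq_mul, Finset.sum_add_distrib, ← Finset.mul_sum]
    calc _ ≤ a * s + b * s := by gcongr
      _ = s := by rw [← add_mul, hab, one_mul]

/-- The simplex is the image of the corner simplex under the affine map sending `0` to `v 0` and the
basis vectors to the other vertices. Spanning makes the linear part `A` invertible, and the constant
is `|det A|`. -/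
lemma integral_convexHull_range {v : Fin (d + 1) → Space d}
    (hv : affineSpan ℝ (Set.range v) = ⊤) :
    ∃ c : ℝ, c ≠ 0 ∧ ∀ g : Space d → ℝ, ∫ x in convexHull ℝ (Set.range v), g x =
      c * ∫ t in cornerSimplex d 1, g (∑ j, barycentric t j • v j) := by
  let A : Space d →ₗ[ℝ] Space d :=
    Fintype.linearCombination ℝ (fun i : Fin d => v i.succ - v 0) ∘ₗ
      (WithLp.linearEquiv 2 ℝ (Fin d → ℝ)).toLinearMap
  have hA : ∀ x, A x = ∑ i, x i • (v i.succ - v 0) := fun x => by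
    simp [A, Fintype.linearCombination_apply]
  have hf : ∀ x : Space d, v 0 + A x = ∑ j, barycentric x.ofLp j • v j := fun x => by
    rw [hA, Fin.sum_univ_succ]
    simp only [barycentric, Fin.cons_zero, Fin.cons_succ, smul_sub, Finset.sum_sub_distrib,
      ← Finset.sum_smul, sub_smul, one_smul]
    abel
  have hsurj : Function.Surjective A := by
    rw [← LinearMap.range_eq_top, eq_top_iff, ← AffineSubspace.direction_top ℝ (Space d) (Space d),
      ← hv, direction_affineSpan, vectorSpan_range_eq_span_range_vsub_right ℝ v 0,
      Submodule.span_le]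
    rintro _ ⟨j, rfl⟩
    refine Fin.cases ⟨0, by simp⟩ (fun i => ⟨EuclideanSpace.single i 1, ?_⟩) j
    rw [hA, Finset.sum_eq_single i] <;> simp +contextual
  have hinj : Function.Injective A := LinearMap.injective_iff_surjective.2 hsurj
  have hdet : LinearMap.det A ≠ 0 :=
    (LinearEquiv.isUnit_det' (LinearEquiv.ofBijective A ⟨hinj, hsurj⟩)).ne_zero
  let E : Set (Space d) := WithLp.ofLp ⁻¹' cornerSimplex d 1
  have hE : MeasurableSet E :=
    ((isClosed_cornerSimplex d 1).preimage (PiLp.continuous_ofLp 2 _)).measurableSet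
  have himage : (fun x => v 0 + A x) '' E = convexHull ℝ (Set.range v) := by
    refine Set.Subset.antisymm ?_ (convexHull_min ?_ ?_)
    · rintro _ ⟨x, hx, rfl⟩
      simp only [hf]
      exact (convex_convexHull ℝ _).sum_mem (fun j _ => barycentric_nonneg hx j)
        (sum_barycentric _) fun j _ => subset_convexHull ℝ _ ⟨j, rfl⟩
    · rintro _ ⟨j, rfl⟩
      refine Fin.cases ⟨0, by simp [E, cornerSimplex], by simp⟩
        (fun i => ⟨EuclideanSpace.single i 1, ⟨fun k => ?_, ?_⟩, ?_⟩) j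
      · by_cases h : k = i <;> simp [h]
      · simp
      · simp only [hA]
        rw [Finset.sum_eq_single i] <;> simp +contextual
    · have hEc : Convex ℝ E :=
        (convex_cornerSimplex d 1).linear_preimage (WithLp.linearEquiv 2 ℝ (Fin d → ℝ)).toLinearMap
      have := (hEc.linear_image A).translate (v 0)
      rwa [Set.image_image] at this
  refine ⟨|LinearMap.det A|, abs_ne_zero.2 hdet, fun g => ?_⟩
  rw [← himage]
  rw [integral_image_eq_integral_abs_det_fderiv_smul volume hE
    (f := fun x => v 0 + A x) (f' := fun _ => A.toContinuousLinearMap)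
    (fun x _ => (A.toContinuousLinearMap.hasFDerivAt.const_add (v 0)).hasFDerivWithinAt)
    (fun x _ y _ h => hinj (add_left_cancel h))]
  have := (PiLp.volume_preserving_ofLp (Fin d)).setIntegral_preimage_emb
    (MeasurableEquiv.toLp 2 (Fin d → ℝ)).symm.measurableEmbedding
    (fun t => g (∑ j, barycentric t j • v j)) (cornerSimplex d 1)
  rw [← this, ← integral_const_mul]
  simp only [hf, smul_eq_mul]
  rfl

lemma integral_prod_barycentric_pow (α : Fin (d + 1) → ℕ) :
    ∫ t in cornerSimplex d 1, ∏ j, barycentric t j ^ α j =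
      (∏ j, ((α j)! : ℝ)) / (∑ j, α j + d)! := by
  have h := integral_cornerSimplex d (fun i => α i.succ) (α 0) 1 zero_le_one
  rw [one_pow, mul_one] at h
  rw [Fin.prod_univ_succ, Fin.sum_univ_succ, add_comm (α 0), mul_comm ((α 0)! : ℝ), ← h]
  congr 1
  ext t
  simp [Fin.prod_univ_succ, barycentric, mul_comm]

end SimplexIntegral

/-! ### The Fantappiè transform of a simplex. -/

/-- The linear form `⟨v, u⟩` in the variables `u_1, …, u_d`. -/
noncomputable def linearForm (v : Space d) : MvPolynomial (Fin d) ℝ := ∑ i, v i • X i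

lemma dualForm_eq_one_sub (v : Space d) : dualForm v = 1 - linearForm v := by
  simp [dualForm, linearForm, smul_eq_C_mul]

lemma isHomogeneous_linearForm (v : Space d) : (linearForm v).IsHomogeneous 1 :=
  IsHomogeneous.sum _ _ _ fun i _ => by
    rw [smul_eq_C_mul]
    exact isHomogeneous_C_mul_X _ _

lemma linearForm_sum_smul {ι : Type*} [Fintype ι] (w : ι → ℝ) (v : ι → Space d) :
    linearForm (∑ j, w j • v j) = ∑ j, w j • linearForm (v j) := by
  simp only [linearForm, Finset.smul_sum]
  rw [Finset.sum_comm]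
  simp [Finset.sum_smul, smul_smul]

lemma multinomial_mul_prod_pow_eq_coeff (I : Fin d →₀ ℕ) (x : Space d) :
    (I.multinomial : ℝ) * ∏ i, x i ^ I i = coeff I (linearForm x ^ I.degree) := by
  rw [linearForm, coeff_linearCombination_X_pow_of_fintype,
    if_pos (by rw [Finsupp.degree_eq_sum, Finsupp.sum_fintype _ _ (by simp)]),
    Finsupp.prod_fintype _ _ (by simp)]

lemma multinomial_mul_prod_factorial (I : Fin d →₀ ℕ) :
    (I.multinomial : ℝ) * ∏ i, ((I i)! : ℝ) = (I.degree)! := by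
  rw [Finsupp.multinomial_eq_of_support_subset (Finset.subset_univ _), mul_comm,
    Finsupp.degree_eq_sum, ← Nat.multinomial_spec]
  push_cast
  rfl

/-- Expand the power of `∑ t_j ⟨v_j, u⟩` by the multinomial theorem. The factorials in Dirichlet's
integral cancel the multinomial coefficients, so every `α` gets the same weight. -/
lemma integral_multinomial_mul_prod_pow (v : Fin (d + 1) → Space d) (I : Fin d →₀ ℕ) :
    ∫ t in cornerSimplex d 1, (I.multinomial : ℝ) * ∏ i, (∑ j, barycentric t j • v j) i ^ I i =
      (I.degree)! / (I.degree + d)! *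
        coeff I (∑ α ∈ Finset.univ.piAntidiag I.degree, ∏ j, linearForm (v j) ^ α j) := by
  have hpt : ∀ t : Fin d → ℝ,
      (I.multinomial : ℝ) * ∏ i, (∑ j, barycentric t j • v j) i ^ I i =
        ∑ α ∈ Finset.univ.piAntidiag I.degree, Nat.multinomial Finset.univ α *
          coeff I (∏ j, linearForm (v j) ^ α j) * ∏ j, barycentric t j ^ α j := by
    intro t
    rw [multinomial_mul_prod_pow_eq_coeff, linearForm_sum_smul, Finset.sum_pow_eq_sum_piAntidiag,
      coeff_sum]
    refine Finset.sum_congr rfl fun α _ => ?_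
    simp only [smul_eq_C_mul, mul_pow, Finset.prod_mul_distrib]
    rw [← C_eq_coe_nat]
    simp only [← map_pow, ← map_prod, coeff_C_mul]
    ring
  simp_rw [hpt]
  rw [integral_finsetSum, coeff_sum, Finset.mul_sum]
  · refine Finset.sum_congr rfl fun α hα => ?_
    have hs : ∑ j, α j = I.degree := (Finset.mem_piAntidiag.1 hα).1
    rw [integral_const_mul, integral_prod_barycentric_pow, hs, ← hs, ← Nat.multinomial_spec]
    push_cast
    ring
  · intro α _
    exact ContinuousOn.integrableOn_compact (isCompact_cornerSimplex d 1)
      (Continuous.continuousOn (by fun_prop))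

lemma moment_standardMeasure (T : Finset (Space d)) (I : Fin d →₀ ℕ) :
    moment I (standardMeasure T) = ∫ x in convexHull ℝ (T : Set (Space d)), ∏ i, x i ^ I i :=
  VectorMeasure.integral_toSignedMeasure

lemma coe_denominator_mul_inv (S : Finset (Space d)) :
    (denominator S : MvPowerSeries (Fin d) ℝ) * (denominator S : MvPowerSeries (Fin d) ℝ)⁻¹ = 1 := by
  refine MvPowerSeries.mul_inv_cancel _ ?_
  rw [← MvPowerSeries.coeff_zero_eq_constantCoeff_apply, MvPolynomial.coeff_coe,
    ← constantCoeff_eq]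
  simp [denominator, dualForm]

/-- The Fantappiè transform of a simplex is a nonzero constant divided by the product of the dual
forms of its vertices. -/
lemma fantappie_standardMeasure {T : Finset (Space d)} (hc : T.card = d + 1)
    (hT : IsSpanning T) : ∃ c : ℝ, c ≠ 0 ∧
      fantappie (standardMeasure T) * (denominator T : MvPowerSeries (Fin d) ℝ) =
        MvPowerSeries.C c := by
  let e : Fin (d + 1) ≃ T := (T.equivFinOfCardEq hc).symm
  let v : Fin (d + 1) → Space d := fun j => e j
  have hv : Set.range v = T := by
    ext x
    constructor
    · rintro ⟨j, rfl⟩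
      exact (e j).2
    · intro hx
      exact ⟨e.symm ⟨x, hx⟩, by simp [v]⟩
  have hden : denominator T = ∏ j, (1 - linearForm (v j)) := by
    rw [denominator, ← Finset.prod_coe_sort, ← e.prod_comp]
    exact Finset.prod_congr rfl fun j _ => dualForm_eq_one_sub _
  obtain ⟨c, hc0, hg⟩ := integral_convexHull_range (v := v) (by rw [hv]; exact hT)
  refine ⟨c, hc0, ?_⟩
  have hF : fantappie (standardMeasure T) = MvPowerSeries.C c * gradedSeries fun n =>
      ∑ α ∈ Finset.univ.piAntidiag n, ∏ j, linearForm (v j) ^ α j := by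
    ext I
    rw [MvPowerSeries.coeff_C_mul, coeff_gradedSeries]
    change ((∑ i, I i + d)! : ℝ) / (∏ i, ((I i)! : ℝ)) * moment I (standardMeasure T) = _
    -- The normalization `(|I| + d)! / I!` is the multinomial coefficient times `(|I| + d)! / |I|!`,
    -- which cancels the remaining factor in `h`.
    have h := integral_multinomial_mul_prod_pow v I
    have hm := multinomial_mul_prod_factorial I
    rw [integral_const_mul] at h
    rw [moment_standardMeasure, ← hv, hg, ← Finsupp.degree_eq_sum]
    have h1 : ((I.degree + d)! : ℝ) ≠ 0 := by positivity
    have h2 : ((I.degree)! : ℝ) ≠ 0 := by positivity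
    have h3 : ∏ i, ((I i)! : ℝ) ≠ 0 := by positivity
    rw [← hm] at h h2
    have h4 := left_ne_zero_of_mul h2
    field_simp at h ⊢
    linear_combination h
  rw [hF, hden, mul_assoc, gradedSeries_piAntidiag_mul_prod
    (fun j => isHomogeneous_linearForm (v j)), mul_one]

/-! ### Transfer from measures to numerators. -/

/-- The signed measures with finite moments. -/
noncomputable def finiteMoments (d : ℕ) : Submodule ℝ (SignedMeasure (Space d)) where
  carrier := {μ | ∀ I : Fin d →₀ ℕ, μ.Integrable fun x => ∏ i, x i ^ I i}
  add_mem' hμ hν I := (hμ I).add_vectorMeasure (hν I)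
  zero_mem' _ := VectorMeasure.Integrable.zero_vectorMeasure
  smul_mem' c _ hμ I := (hμ I).smul_vectorMeasure c

/-- The Fantappiè transform as a linear map on the signed measures with finite moments. -/
noncomputable def fantappieLinear (d : ℕ) : finiteMoments d →ₗ[ℝ] MvPowerSeries (Fin d) ℝ where
  toFun μ := fantappie μ
  map_add' μ ν := by
    ext I
    simp only [map_add]
    simp only [MvPowerSeries.coeff_apply, fantappie, moment, Submodule.coe_add]
    -- Additivity uses integrability of the monomials, hence the restriction to `finiteMoments`.
    rw [VectorMeasure.integral_add_vectorMeasure (μ.2 I) (ν.2 I), mul_add]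
  map_smul' c μ := by
    ext I
    simp only [MvPowerSeries.coeff_smul, RingHom.id_apply]
    simp only [MvPowerSeries.coeff_apply, fantappie, moment, Submodule.coe_smul]
    rw [VectorMeasure.integral_smul_vectorMeasure, smul_eq_mul]
    ring

lemma standardMeasure_mem_finiteMoments (T : Finset (Space d)) :
    standardMeasure T ∈ finiteMoments d := by
  intro I
  rw [VectorMeasure.Integrable, standardMeasure, Measure.variation_toSignedMeasure]
  exact ContinuousOn.integrableOn_compact (T.finite_toSet.isCompact_convexHull ℝ)
    (Continuous.continuousOn (by fun_prop))

/-- Division of a polynomial by `Φ_S`. -/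
noncomputable def divDenominator (S : Finset (Space d)) :
    MvPolynomial (Fin d) ℝ →ₗ[ℝ] MvPowerSeries (Fin d) ℝ where
  toFun P := (P : MvPowerSeries (Fin d) ℝ) * (denominator S : MvPowerSeries (Fin d) ℝ)⁻¹
  map_add' P Q := by rw [MvPolynomial.coe_add, add_mul]
  map_smul' c P := by rw [MvPolynomial.coe_smul, smul_mul_assoc, RingHom.id_apply]

lemma divDenominator_injective (S : Finset (Space d)) :
    Function.Injective (divDenominator S) := by
  intro P Q h
  have h' := congrArg (· * (denominator S : MvPowerSeries (Fin d) ℝ)) h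
  simp only [divDenominator, LinearMap.coe_mk, AddHom.coe_mk, mul_assoc] at h'
  rw [mul_comm _ (denominator S : MvPowerSeries (Fin d) ℝ), coe_denominator_mul_inv, mul_one,
    mul_one] at h'
  exact MvPolynomial.coe_injective _ _ h'

lemma divDenominator_sdiff {S T : Finset (Space d)} (h : T ⊆ S) :
    divDenominator S (denominator (S \ T)) * (denominator T : MvPowerSeries (Fin d) ℝ) = 1 := by
  have : denominator S = denominator (S \ T) * denominator T :=
    (Finset.prod_sdiff h).symm
  rw [divDenominator, LinearMap.coe_mk, AddHom.coe_mk, mul_right_comm, ← MvPolynomial.coe_mul,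
    ← this, coe_denominator_mul_inv]

lemma exists_fantappie_eq_smul {S T : Finset (Space d)} (h : T ⊆ S) (hc : T.card = d + 1)
    (hT : IsSpanning T) : ∃ c : ℝ, c ≠ 0 ∧
      fantappie (standardMeasure T) = c • divDenominator S (denominator (S \ T)) := by
  obtain ⟨c, hc0, hF⟩ := fantappie_standardMeasure hc hT
  refine ⟨c, hc0, ?_⟩
  rw [MvPowerSeries.smul_eq_C_mul, ← hF, mul_assoc,
    mul_comm (denominator T : MvPowerSeries (Fin d) ℝ), divDenominator_sdiff h, mul_one]

lemma fantappieSpace_eq_image (S : Finset (Space d)) :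
    fantappieSpace S = divDenominator S '' (complementProducts S : Set _) := by
  refine Set.Subset.antisymm ?_ ?_
  · have key : simplexMeasures S ≤
        (((complementProducts S).map (divDenominator S)).comap (fantappieLinear d)).map
          (finiteMoments d).subtype := by
      refine Submodule.span_le.2 ?_
      rintro μ ⟨T, hTS, hc, hT, rfl⟩
      refine ⟨⟨_, standardMeasure_mem_finiteMoments T⟩, ?_, rfl⟩
      obtain ⟨c, -, hF⟩ := exists_fantappie_eq_smul hTS hc hT
      change fantappie (standardMeasure T) ∈ (complementProducts S).map (divDenominator S)
      rw [hF]
      exact Submodule.smul_mem _ _ (Submodule.mem_map_of_mem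
        (Submodule.subset_span ⟨T, hTS, hc, hT, rfl⟩))
    rintro _ ⟨μ, hμ, rfl⟩
    obtain ⟨μ', h, rfl⟩ := key hμ
    exact h
  · have key : complementProducts S ≤ (((simplexMeasures S).comap (finiteMoments d).subtype).map
        (fantappieLinear d)).comap (divDenominator S) := by
      refine Submodule.span_le.2 ?_
      rintro p ⟨T, hTS, hc, hT, rfl⟩
      obtain ⟨c, hc0, hF⟩ := exists_fantappie_eq_smul hTS hc hT
      -- Here `c ≠ 0` matters: each complement product must be recovered from its simplex.
      refine ⟨c⁻¹ • ⟨_, standardMeasure_mem_finiteMoments T⟩,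
        Submodule.smul_mem _ _ (Submodule.subset_span ⟨T, hTS, hc, hT, rfl⟩), ?_⟩
      rw [map_smul]
      change c⁻¹ • fantappie (standardMeasure T) = _
      rw [hF, inv_smul_smul₀ hc0]
    rintro _ ⟨p, hp, rfl⟩
    obtain ⟨μ, hμ, h⟩ := key hp
    exact ⟨μ, hμ, h⟩

lemma ratSpace_eq_image (S : Finset (Space d)) :
    ratSpace S = divDenominator S '' {P | P.totalDegree ≤ S.card - d - 1} := by
  ext R
  exact ⟨fun ⟨P, hP, h⟩ => ⟨P, hP, h.symm⟩, fun ⟨P, hP, h⟩ => ⟨P, hP, h.symm⟩⟩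

end FantappieSimplex

theorem proposition1p10 (d : ℕ) (S : Finset (FantappieSimplex.Space d))
    (hS : FantappieSimplex.IsSpanning S) :
    FantappieSimplex.fantappieSpace S = FantappieSimplex.ratSpace S ↔
      FantappieSimplex.StronglyNondegenerate S := by
  rw [FantappieSimplex.fantappieSpace_eq_image, FantappieSimplex.ratSpace_eq_image,
    (FantappieSimplex.divDenominator_injective S).image_injective.eq_iff,
    FantappieSimplex.coe_complementProducts_eq_iff hS]
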